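/- Let $d\ge 1$ be an integer and let $0<\omega<1$. Then there exists a nontrivial positive solution of the radial solitary-wave problem for the focusing saturated cubic Schrödinger equation in dimension $d$ $$-u''-\frac{d-1}{r}\,u'+\omega u=\frac{u^3}{1+u^2}\quad\text{on } ]0,\infty[,\qquad u\in H^2(]0,\infty[),\qquad u'(0)=0.$$ That is, there is a function $u:[0,\infty[\to\mathbb{R}$ with $u(r)>0$ for all $r\ge 0$, of class $C^2$ on $]0,\infty[$, which satisfies the equation at every $r>0$, has right derivative $u'(0)=0$ at $r=0$, and is such that $u$ and its weak derivatives $u'$, $u''$ belong to $L^2(]0,\infty[)$ (Lebesgue measure $dr$). -/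

import Mathlib

open MeasureTheory Set

/-- `g` is the weak (distributional) derivative of `f` on the open set `Ω ⊆ ℝ`: both are locally
integrable on `Ω`, and `∫_Ω f φ' = - ∫_Ω g φ` for every `φ ∈ C_c^∞(Ω)`. -/
def HasWeakDerivOn (f g : ℝ → ℝ) (Ω : Set ℝ) : Prop :=
  LocallyIntegrableOn f Ω ∧ LocallyIntegrableOn g Ω ∧
    ∀ φ : ℝ → ℝ, ContDiff ℝ (⊤ : ℕ∞) φ → HasCompactSupport φ → tsupport φ ⊆ Ω →
      ∫ x in Ω, f x * deriv φ x = -∫ x in Ω, g x * φ x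

/-- `u ∈ H²(Ω)`: `u` belongs to `L²(Ω)`, and so do its weak derivatives of orders one and two. -/
def MemH2 (u : ℝ → ℝ) (Ω : Set ℝ) : Prop :=
  MemLp u 2 (volume.restrict Ω) ∧
    ∃ v w : ℝ → ℝ, HasWeakDerivOn u v Ω ∧ HasWeakDerivOn v w Ω ∧
      MemLp v 2 (volume.restrict Ω) ∧ MemLp w 2 (volume.restrict Ω)

/-- `u` solves the radial problem in dimension `d` with frequency `ω`:
`-u'' - (d - 1) / r * u' + ω u = u³ / (1 + u²)` on `]0, ∞[`, `u ∈ H²(]0, ∞[)`, `u'(0) = 0`.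
Only the values of `u` on `[0, ∞[` matter. The equation holds in the classical sense, and `u'(0)`
is the right derivative at `0`. -/
structure IsRadialSolitaryWave (d : ℕ) (ω : ℝ) (u : ℝ → ℝ) : Prop where
  contDiffOn : ContDiffOn ℝ 2 u (Ioi 0)
  ode : ∀ r : ℝ, 0 < r →
    -deriv (deriv u) r - ((d : ℝ) - 1) / r * deriv u r + ω * u r = u r ^ 3 / (1 + u r ^ 2)
  memH2 : MemH2 u (Ioi 0)
  deriv_zero : HasDerivWithinAt u 0 (Ici 0) 0

/-! The proof is a shooting argument. With `n = d - 1`, `c = 1 - ω` and p = -u', the equation reads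
p' + (n/r) p = f(u), where f is `saturated c`; p is the weighted mean of f(u), which absorbs the
singularity at 0. Each initial height a gives a unique solution on the half-line, since f is
globally Lipschitz.

The energy E = p²/2 + F(u), with F' = f, is nonincreasing. Heights whose solution becomes negative
form an open set, nonempty because f is linear up to a bounded error and the linear equation
oscillates. Heights whose solution reaches negative energy while still positive form an open set,
nonempty because F < 0 near 0. The two sets are disjoint, as E ≥ 0 at a zero of u. Since ]0, ∞[ is
connected, some height lies in neither (`exists_radialIVP_saturated_pos`): there u > 0 and E ≥ 0
throughout.

These two properties give decay. Wherever p = 0, E ≥ 0 makes f(u) > 0, so p > 0 for r > 0 and u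
decreases. Then p is bounded with integral at most a, hence in L². Finally u enters the region F <
0, where E ≥ 0 bounds u² by a multiple of p². -/

open scoped BoundedContinuousFunction

/-! ### Weighted means and Gronwall estimates -/

/-- The weighted mean `r ∫₀¹ sⁿ g(rs) ds`, equal to `r⁻ⁿ ∫₀ʳ tⁿ g(t) dt` for `r > 0`. -/
noncomputable def radialMean (n : ℕ) (g : ℝ → ℝ) (r : ℝ) : ℝ :=
  r * ∫ s in (0 : ℝ)..1, s ^ n * g (r * s)

theorem continuous_radialMean (n : ℕ) {g : ℝ → ℝ} (hg : Continuous g) :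
    Continuous (radialMean n g) := by
  unfold radialMean
  refine continuous_id.mul ?_
  apply intervalIntegral.continuous_parametric_intervalIntegral_of_continuous'
  fun_prop

theorem radialMean_zero (n : ℕ) (g : ℝ → ℝ) : radialMean n g 0 = 0 := by
  simp [radialMean]

theorem radialMean_congr (n : ℕ) {g h : ℝ → ℝ} (H : ∀ t, 0 ≤ t → g t = h t) {r : ℝ}
    (hr : 0 ≤ r) : radialMean n g r = radialMean n h r := by
  unfold radialMean
  congr 1
  apply intervalIntegral.integral_congr
  intro s hs
  rw [uIcc_of_le zero_le_one] at hs
  simp only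
  rw [H _ (mul_nonneg hr hs.1)]

theorem radialMean_sub (n : ℕ) {g h : ℝ → ℝ} (hg : Continuous g) (hh : Continuous h) (r : ℝ) :
    radialMean n (fun t => g t - h t) r = radialMean n g r - radialMean n h r := by
  unfold radialMean
  rw [← mul_sub, ← intervalIntegral.integral_sub]
  · congr 2
    ext s
    ring
  · exact Continuous.intervalIntegrable (by fun_prop) _ _
  · exact Continuous.intervalIntegrable (by fun_prop) _ _

theorem radialMean_const_mul (n : ℕ) (c : ℝ) (g : ℝ → ℝ) (r : ℝ) :
    radialMean n (fun t => c * g t) r = c * radialMean n g r := by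
  unfold radialMean
  have : ∀ s : ℝ, s ^ n * (c * g (r * s)) = c * (s ^ n * g (r * s)) := fun s => by ring
  simp only [this, intervalIntegral.integral_const_mul]
  ring

theorem radialMean_eq_div (n : ℕ) (g : ℝ → ℝ) {r : ℝ} (hr : 0 < r) :
    radialMean n g r = (∫ t in (0 : ℝ)..r, t ^ n * g t) / r ^ n := by
  unfold radialMean
  have h := intervalIntegral.mul_integral_comp_mul_left (a := 0) (b := 1)
    (f := fun t => t ^ n * g t) r
  simp only [mul_zero, mul_one] at h
  rw [← h, eq_div_iff (by positivity), mul_assoc, mul_comm _ (r ^ n),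
    ← intervalIntegral.integral_const_mul]
  congr 2
  ext s
  ring

/-- Recovers the second-order equation from the integrated one, by differentiating the quotient form
away from 0. -/
theorem hasDerivAt_radialMean (n : ℕ) {g : ℝ → ℝ} (hg : Continuous g) {r : ℝ} (hr : 0 < r) :
    HasDerivAt (radialMean n g) (g r - n / r * radialMean n g r) r := by
  have h1 : HasDerivAt (fun x => ∫ t in (0 : ℝ)..x, t ^ n * g t) (r ^ n * g r) r := by
    have : Continuous fun t : ℝ => t ^ n * g t := by fun_prop
    exact this.integral_hasStrictDerivAt 0 r |>.hasDerivAt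
  have h2 := h1.div (hasDerivAt_pow n r) (by positivity)
  have h3 : HasDerivAt (radialMean n g) _ r := h2.congr_of_eventuallyEq (by
    filter_upwards [lt_mem_nhds hr] with x hx
    exact radialMean_eq_div n g hx)
  convert h3 using 1
  rw [radialMean_eq_div n g hr]
  -- The exponent `n - 1` in the derivative of `r ^ n` is truncated, so `n = 0` is separate.
  rcases n with _ | m
  · simp
  · field_simp
    simp
    ring

theorem abs_radialMean_le (n : ℕ) {g φ : ℝ → ℝ} (hφ : Continuous φ) {r : ℝ}
    (hr : 0 ≤ r) (h : ∀ t ∈ Icc 0 r, |g t| ≤ φ t) :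
    |radialMean n g r| ≤ ∫ t in (0 : ℝ)..r, φ t := by
  have h' := intervalIntegral.mul_integral_comp_mul_left (a := 0) (b := 1) (f := φ) r
  simp only [mul_zero, mul_one] at h'
  rw [← h', radialMean, abs_mul, abs_of_nonneg hr]
  gcongr
  rw [← Real.norm_eq_abs]
  refine intervalIntegral.norm_integral_le_of_norm_le zero_le_one ?_ ?_
  · refine Filter.Eventually.of_forall fun s hs => ?_
    have hs0 := hs.1.le
    rw [norm_mul, Real.norm_eq_abs, Real.norm_eq_abs, abs_of_nonneg (by positivity)]
    calc s ^ n * |g (r * s)| ≤ 1 * |g (r * s)| := by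
          gcongr
          exact pow_le_one₀ hs0 hs.2
      _ ≤ φ (r * s) := by
          rw [one_mul]
          exact h _ ⟨by positivity, mul_le_of_le_one_right hr hs.2⟩
  · exact Continuous.intervalIntegrable (by fun_prop) _ _

theorem le_radialMean (n : ℕ) {g : ℝ → ℝ} (hg : Continuous g) {r c : ℝ} (hr : 0 ≤ r)
    (h : ∀ t ∈ Icc 0 r, c ≤ g t) : r * (c / (n + 1)) ≤ radialMean n g r := by
  unfold radialMean
  gcongr
  have : ∫ s in (0 : ℝ)..1, s ^ n * c = c / (n + 1) := by
    rw [intervalIntegral.integral_mul_const, integral_pow]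
    simp
    ring
  rw [← this]
  apply intervalIntegral.integral_mono_on zero_le_one
  · exact Continuous.intervalIntegrable (by fun_prop) _ _
  · exact Continuous.intervalIntegrable (by fun_prop) _ _
  · intro s hs
    have := hs.1
    gcongr
    exact h _ ⟨by positivity, mul_le_of_le_one_right hr hs.2⟩

theorem integral_exp_mul_le {k : ℝ} (hk : 0 < k) (r : ℝ) :
    ∫ t in (0 : ℝ)..r, Real.exp (k * t) ≤ Real.exp (k * r) / k := by
  rw [intervalIntegral.integral_comp_mul_left (fun t => Real.exp t) hk.ne', integral_exp,
    smul_eq_mul, mul_zero, Real.exp_zero, inv_mul_eq_div]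
  gcongr
  linarith

/-- Each of the two integrations of exp(kt) gains a factor 1/k; the resulting 1/k² drives both the
Gronwall estimate and the contraction. -/
theorem abs_integral_radialMean_le (n : ℕ) {g : ℝ → ℝ} {A B k r : ℝ}
    (hA : 0 ≤ A) (hB : 0 ≤ B) (hk : 0 < k) (hr : 0 ≤ r)
    (h : ∀ t ∈ Icc 0 r, |g t| ≤ A * Real.exp (k * t) + B) :
    |∫ s in (0 : ℝ)..r, radialMean n g s| ≤ A * Real.exp (k * r) / k ^ 2 + B * r ^ 2 := by
  have key : ∀ s ∈ Icc 0 r, |radialMean n g s| ≤ A / k * Real.exp (k * s) + B * r := by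
    intro s hs
    calc |radialMean n g s| ≤ ∫ t in (0 : ℝ)..s, (A * Real.exp (k * t) + B) :=
          abs_radialMean_le n (by fun_prop) hs.1 fun t ht => h t ⟨ht.1, ht.2.trans hs.2⟩
      _ = A * (∫ t in (0 : ℝ)..s, Real.exp (k * t)) + B * s := by
          rw [intervalIntegral.integral_add, intervalIntegral.integral_const_mul,
            intervalIntegral.integral_const, smul_eq_mul]
          · ring
          · exact Continuous.intervalIntegrable (by fun_prop) _ _
          · exact Continuous.intervalIntegrable (by fun_prop) _ _
      _ ≤ A * (Real.exp (k * s) / k) + B * r := by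
          gcongr
          · exact integral_exp_mul_le hk s
          · exact hs.2
      _ = _ := by ring
  calc |∫ s in (0 : ℝ)..r, radialMean n g s|
      ≤ ∫ s in (0 : ℝ)..r, (A / k * Real.exp (k * s) + B * r) := by
        rw [← Real.norm_eq_abs]
        refine intervalIntegral.norm_integral_le_of_norm_le hr ?_ ?_
        · exact Filter.Eventually.of_forall fun s hs => key s ⟨hs.1.le, hs.2⟩
        · exact Continuous.intervalIntegrable (by fun_prop) _ _
    _ = A / k * (∫ t in (0 : ℝ)..r, Real.exp (k * t)) + B * r * r := by
        rw [intervalIntegral.integral_add, intervalIntegral.integral_const_mul,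
          intervalIntegral.integral_const, smul_eq_mul]
        · ring
        · exact Continuous.intervalIntegrable (by fun_prop) _ _
        · exact Continuous.intervalIntegrable (by fun_prop) _ _
    _ ≤ A / k * (Real.exp (k * r) / k) + B * r * r := by
        gcongr
        exact integral_exp_mul_le hk r
    _ = _ := by
        field_simp

/-- Gronwall-type estimate for the integrated radial equation. -/
theorem abs_le_of_eq_sub_integral_radialMean (n : ℕ) {z g : ℝ → ℝ} (hz : Continuous z)
    {δ L η r : ℝ} (hL : 0 ≤ L) (hη : 0 ≤ η) (hr : 0 ≤ r)
    (heq : ∀ t, 0 ≤ t → z t = δ - ∫ s in (0 : ℝ)..t, radialMean n g s)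
    (hgz : ∀ t, 0 ≤ t → |g t| ≤ L * |z t| + η) {t : ℝ} (ht : t ∈ Icc 0 r) :
    |z t| ≤ 2 * (|δ| + η * r ^ 2) * Real.exp ((L + 1) * r) := by
  have hk : 0 < L + 1 := by linarith
  obtain ⟨t₀, ht₀, hmax⟩ := isCompact_Icc.exists_isMaxOn (nonempty_Icc.2 hr)
    (f := fun t => |z t| * Real.exp (-((L + 1) * t))) (by fun_prop)
  set M := |z t₀| * Real.exp (-((L + 1) * t₀)) with hM
  have hM0 : 0 ≤ M := by positivity
  have hzM : ∀ t ∈ Icc 0 r, |z t| ≤ M * Real.exp ((L + 1) * t) := by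
    intro t ht
    have := hmax ht
    simp only [mem_ofPred_eq] at this
    calc |z t| = |z t| * Real.exp (-((L + 1) * t)) * Real.exp ((L + 1) * t) := by
          rw [mul_assoc, ← Real.exp_add]
          simp
      _ ≤ _ := by gcongr
  have hz0 : |z t₀| = M * Real.exp ((L + 1) * t₀) := by
    rw [hM, mul_assoc, ← Real.exp_add]
    simp
  have hint := abs_integral_radialMean_le n (A := L * M) (B := η) (by positivity) hη hk ht₀.1
    (fun t ht => (hgz t ht.1).trans (by
      have := hzM t ⟨ht.1, ht.2.trans ht₀.2⟩
      rw [mul_assoc]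
      gcongr))
  have h1 : |z t₀| ≤ |δ| + (L * M * Real.exp ((L + 1) * t₀) / (L + 1) ^ 2 + η * r ^ 2) := by
    rw [heq t₀ ht₀.1]
    refine (abs_sub _ _).trans ?_
    gcongr
    refine hint.trans ?_
    gcongr
    · exact ht₀.1
    · exact ht₀.2
  -- Since 2L ≤ (L + 1)², the integral term is at most half of |z t₀| and can be absorbed.
  have h2 : L * M * Real.exp ((L + 1) * t₀) / (L + 1) ^ 2
      ≤ M * Real.exp ((L + 1) * t₀) / 2 := by
    rw [div_le_div_iff₀ (by positivity) (by norm_num)]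
    have : 0 ≤ M * Real.exp ((L + 1) * t₀) := by positivity
    nlinarith [mul_nonneg this (sq_nonneg L), this]
  have he : 1 ≤ Real.exp ((L + 1) * t₀) := Real.one_le_exp (mul_nonneg hk.le ht₀.1)
  have hM2 : M ≤ 2 * (|δ| + η * r ^ 2) := by
    rw [hz0] at h1
    nlinarith
  calc |z t| ≤ M * Real.exp ((L + 1) * t) := hzM t ht
    _ ≤ _ := by
      gcongr
      exact ht.2

/-! ### The initial value problem: existence, continuous dependence, positivity -/

/-- `u` solves `u'' + (n / r) u' + f(u) = 0`, `u(0) = a`, `u'(0) = 0`, in integrated form. -/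
structure IsRadialIVP (n : ℕ) (f : ℝ → ℝ) (a : ℝ) (u : ℝ → ℝ) : Prop where
  continuous : Continuous u
  init : u 0 = a
  hasDerivAt : ∀ r, 0 ≤ r → HasDerivAt u (-radialMean n (fun t => f (u t)) r) r

theorem continuous_of_abs_sub_le {f : ℝ → ℝ} {L : ℝ} (hL : 0 ≤ L)
    (hf : ∀ x y, |f x - f y| ≤ L * |x - y|) : Continuous f :=
  (LipschitzWith.of_dist_le_mul (K := ⟨L, hL⟩) hf).continuous

theorem IsRadialIVP.eq_sub_integral {n : ℕ} {f : ℝ → ℝ} {a : ℝ} {u : ℝ → ℝ}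
    (h : IsRadialIVP n f a u) (hf : Continuous f) {r : ℝ} (hr : 0 ≤ r) :
    u r = a - ∫ s in (0 : ℝ)..r, radialMean n (fun t => f (u t)) s := by
  have hc : Continuous fun t => f (u t) := hf.comp h.continuous
  have := intervalIntegral.integral_eq_sub_of_hasDerivAt (a := 0) (b := r) (f := u)
    (f' := fun s => -radialMean n (fun t => f (u t)) s)
    (fun s hs => h.hasDerivAt s (by rw [uIcc_of_le hr] at hs; exact hs.1))
    ((continuous_radialMean n hc).neg.intervalIntegrable _ _)
  rw [intervalIntegral.integral_neg, h.init] at this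
  linarith

/-- Banach's fixed point theorem in the norm weighted by exp(-k|t|), k = L + 1: the Lipschitz factor
is L/k² ≤ 1/2. -/
theorem exists_isRadialIVP (n : ℕ) {f : ℝ → ℝ} {L : ℝ} (hL : 0 ≤ L)
    (hf : ∀ x y, |f x - f y| ≤ L * |x - y|) (hf0 : f 0 = 0) (a : ℝ) :
    ∃ u, IsRadialIVP n f a u := by
  have hfc := continuous_of_abs_sub_le hL hf
  set k := L + 1 with hkdef
  have hk : 0 < k := by linarith
  set U : (ℝ →ᵇ ℝ) → ℝ → ℝ := fun w t => Real.exp (k * |t|) * w t with hU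
  have hUc : ∀ w, Continuous (U w) := fun w => by
    have := w.continuous
    fun_prop
  have hfU : ∀ w, Continuous fun t => f (U w t) := fun w => hfc.comp (hUc w)
  have hRc : ∀ w, Continuous (radialMean n fun t => f (U w t)) :=
    fun w => continuous_radialMean n (hfU w)
  set G : (ℝ →ᵇ ℝ) → ℝ → ℝ :=
    fun w r => a - ∫ s in (0 : ℝ)..r, radialMean n (fun t => f (U w t)) s with hG
  have hGd : ∀ w r, HasDerivAt (G w) (-radialMean n (fun t => f (U w t)) r) r := fun w r =>
    ((hRc w).integral_hasStrictDerivAt 0 r).hasDerivAt.const_sub a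
  have hGc : ∀ w, Continuous (G w) := fun w =>
    continuous_iff_continuousAt.2 fun r => (hGd w r).continuousAt
  have hdiff : ∀ v w r, 0 ≤ r →
      |G v r - G w r| ≤ (1 / 2) * dist v w * Real.exp (k * r) := by
    intro v w r hr
    have h1 : G v r - G w r = -∫ s in (0 : ℝ)..r,
        radialMean n (fun t => f (U v t) - f (U w t)) s := by
      simp only [radialMean_sub n (hfU v) (hfU w)]
      rw [intervalIntegral.integral_sub ((hRc v).intervalIntegrable _ _)
        ((hRc w).intervalIntegrable _ _)]
      simp only [hG]
      ring
    rw [h1, abs_neg]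
    refine (abs_integral_radialMean_le n (A := L * dist v w) (B := 0)
      (by positivity) le_rfl hk hr ?_).trans ?_
    · intro t ht
      refine (hf _ _).trans ?_
      simp only [hU, ← mul_sub, abs_mul, Real.abs_exp, abs_of_nonneg ht.1]
      have : |v t - w t| ≤ dist v w := by
        rw [← Real.dist_eq]
        exact BoundedContinuousFunction.dist_coe_le_dist t
      rw [add_zero, mul_assoc, mul_comm (dist v w)]
      gcongr
    · rw [zero_mul, add_zero, div_le_iff₀ (by positivity)]
      have : 0 ≤ dist v w * Real.exp (k * r) := by positivity
      rw [hkdef] at this ⊢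
      nlinarith [mul_nonneg this (sq_nonneg L), this]
  have hG0 : ∀ r, G 0 r = a := fun r => by simp [hG, hU, hf0, radialMean]
  set T : (ℝ →ᵇ ℝ) → (ℝ →ᵇ ℝ) := fun w =>
    BoundedContinuousFunction.ofNormedAddCommGroup
      (fun r => Real.exp (-(k * |r|)) * G w |r|)
      (by have := hGc w; fun_prop) (|a| + 1 / 2 * dist w 0) (fun r => by
        have h1 := hdiff w 0 |r| (abs_nonneg r)
        rw [hG0] at h1
        rw [norm_mul, Real.norm_eq_abs, Real.norm_eq_abs, Real.abs_exp, Real.exp_neg,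
          inv_mul_le_iff₀ (by positivity)]
        have h2 : |G w (|r|)| ≤ |a| + |G w (|r|) - a| := by
          have := abs_add_le a (G w |r| - a)
          rwa [add_sub_cancel] at this
        have he : 1 ≤ Real.exp (k * |r|) := Real.one_le_exp (by positivity)
        nlinarith [abs_nonneg a]) with hT
  have hTc : ContractingWith (1 / 2) T := by
    refine ⟨by rw [← NNReal.coe_lt_coe]; norm_num, LipschitzWith.of_dist_le_mul fun v w => ?_⟩
    rw [BoundedContinuousFunction.dist_le (by positivity)]
    intro r
    have h1 := hdiff v w |r| (abs_nonneg r)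
    simp only [hT, BoundedContinuousFunction.coe_ofNormedAddCommGroup]
    rw [Real.dist_eq, ← mul_sub, abs_mul, Real.abs_exp, Real.exp_neg,
      inv_mul_le_iff₀ (by positivity)]
    refine h1.trans (le_of_eq ?_)
    push_cast
    ring
  obtain ⟨w, hw⟩ : ∃ w, T w = w := ⟨_, hTc.fixedPoint_isFixedPt⟩
  have hUG : ∀ r, 0 ≤ r → U w r = G w r := by
    intro r hr
    have h1 : w r = Real.exp (-(k * |r|)) * G w |r| := by
      conv_lhs => rw [← hw]
      rfl
    simp only [hU]
    rw [h1, ← mul_assoc, ← Real.exp_add, add_neg_cancel, Real.exp_zero, one_mul,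
      abs_of_nonneg hr]
  -- `G w` rather than `U w` is the witness: it is differentiable on all of ℝ by construction and
  -- agrees with `U w` for r ≥ 0, where alone the mean samples it.
  refine ⟨G w, hGc w, by simp [hG], fun r hr => ?_⟩
  rw [radialMean_congr n (g := fun t => f (G w t)) (h := fun t => f (U w t))
    (fun t ht => by rw [hUG t ht]) hr]
  exact hGd w r

/-- Two nonlinearities and a defect η are allowed so as to cover both continuous dependence (η = 0)
and comparison with the linear equation (η = 1/2). -/
theorem IsRadialIVP.abs_sub_le {n : ℕ} {f g : ℝ → ℝ} {a b : ℝ} {u v : ℝ → ℝ}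
    (hu : IsRadialIVP n f a u) (hv : IsRadialIVP n g b v) (hf : Continuous f) (hg : Continuous g)
    {L η r : ℝ} (hL : 0 ≤ L) (hη : 0 ≤ η) (hr : 0 ≤ r)
    (h : ∀ t, |f (u t) - g (v t)| ≤ L * |u t - v t| + η) {t : ℝ} (ht : t ∈ Icc 0 r) :
    |u t - v t| ≤ 2 * (|a - b| + η * r ^ 2) * Real.exp ((L + 1) * r) := by
  have hfu : Continuous fun t => f (u t) := hf.comp hu.continuous
  have hgv : Continuous fun t => g (v t) := hg.comp hv.continuous
  refine abs_le_of_eq_sub_integral_radialMean n (z := fun t => u t - v t)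
    (g := fun t => f (u t) - g (v t)) (hu.continuous.sub hv.continuous) hL hη hr ?_
    (fun t _ => h t) ht
  intro t ht
  simp only [radialMean_sub n hfu hgv]
  rw [intervalIntegral.integral_sub ((continuous_radialMean n hfu).intervalIntegrable _ _)
    ((continuous_radialMean n hgv).intervalIntegrable _ _), hu.eq_sub_integral hf ht,
    hv.eq_sub_integral hg ht]
  ring

section Lipschitz

variable {n : ℕ} {f : ℝ → ℝ} {L : ℝ}

theorem IsRadialIVP.abs_sub_le_of_lipschitz {a b : ℝ} {u v : ℝ → ℝ}
    (hL : 0 ≤ L) (hf : ∀ x y, |f x - f y| ≤ L * |x - y|)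
    (hu : IsRadialIVP n f a u) (hv : IsRadialIVP n f b v)
    {t r : ℝ} (ht : t ∈ Icc 0 r) :
    |u t - v t| ≤ 2 * Real.exp ((L + 1) * r) * |a - b| := by
  have hfc := continuous_of_abs_sub_le hL hf
  have := hu.abs_sub_le hv hfc hfc (η := 0) hL le_rfl (ht.1.trans ht.2)
    (fun t => by simpa using hf (u t) (v t)) ht
  linarith

theorem continuous_of_forall_abs_sub_le {φ : ℝ → ℝ} {C : ℝ}
    (h : ∀ a b, |φ a - φ b| ≤ C * |a - b|) : Continuous φ :=
  continuous_of_abs_sub_le (L := max C 0) (le_max_right _ _) fun a b =>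
    (h a b).trans (by gcongr; exact le_max_left _ _)

theorem continuous_radialIVP (hL : 0 ≤ L) (hf : ∀ x y, |f x - f y| ≤ L * |x - y|)
    {U : ℝ → ℝ → ℝ} (hU : ∀ a, IsRadialIVP n f a (U a)) {r : ℝ} (hr : 0 ≤ r) :
    Continuous fun a => U a r :=
  continuous_of_forall_abs_sub_le fun a b =>
    (hU a).abs_sub_le_of_lipschitz hL hf (hU b) ⟨hr, le_rfl⟩

theorem continuous_radialMean_radialIVP (hL : 0 ≤ L) (hf : ∀ x y, |f x - f y| ≤ L * |x - y|)
    {U : ℝ → ℝ → ℝ} (hU : ∀ a, IsRadialIVP n f a (U a)) {r : ℝ} (hr : 0 ≤ r) :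
    Continuous fun a => radialMean n (fun t => f (U a t)) r := by
  have hfc := continuous_of_abs_sub_le hL hf
  refine continuous_of_forall_abs_sub_le (C := r * (L * (2 * Real.exp ((L + 1) * r))))
    fun a b => ?_
  have hcU : ∀ a, Continuous fun t => f (U a t) := fun a => hfc.comp (hU a).continuous
  rw [← radialMean_sub n (hcU a) (hcU b)]
  refine (abs_radialMean_le n
    (φ := fun _ => L * (2 * Real.exp ((L + 1) * r) * |a - b|)) continuous_const hr ?_).trans ?_
  · intro t ht
    refine (hf _ _).trans ?_
    gcongr
    exact (hU a).abs_sub_le_of_lipschitz hL hf (hU b) ht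
  · rw [intervalIntegral.integral_const, smul_eq_mul]
    apply le_of_eq
    ring

theorem isOpen_exists_neg (hL : 0 ≤ L) (hf : ∀ x y, |f x - f y| ≤ L * |x - y|)
    {U : ℝ → ℝ → ℝ} (hU : ∀ a, IsRadialIVP n f a (U a)) :
    IsOpen {a | ∃ r, 0 ≤ r ∧ U a r < 0} := by
  have : {a | ∃ r, 0 ≤ r ∧ U a r < 0} = ⋃ r : {r : ℝ // 0 ≤ r}, {a | U a r < 0} := by
    ext a
    simp
  rw [this]
  exact isOpen_iUnion fun r => isOpen_lt (continuous_radialIVP hL hf hU r.2) continuous_const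

/-- The minimum over [0, r] is positive by compactness, and dependence on the height is Lipschitz
uniformly on [0, r]. -/
theorem isOpen_forall_pos (hL : 0 ≤ L) (hf : ∀ x y, |f x - f y| ≤ L * |x - y|)
    {U : ℝ → ℝ → ℝ} (hU : ∀ a, IsRadialIVP n f a (U a)) {r : ℝ} (hr : 0 ≤ r) :
    IsOpen {a | ∀ s ∈ Icc 0 r, 0 < U a s} := by
  rw [Metric.isOpen_iff]
  intro a ha
  obtain ⟨s₀, hs₀, hmin⟩ := isCompact_Icc.exists_isMinOn (nonempty_Icc.2 hr)
    (hU a).continuous.continuousOn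
  have hm : 0 < U a s₀ := ha s₀ hs₀
  have hC : 0 < 2 * Real.exp ((L + 1) * r) := by positivity
  refine ⟨U a s₀ / (2 * Real.exp ((L + 1) * r)), by positivity, fun b hb s hs => ?_⟩
  have h1 := (hU b).abs_sub_le_of_lipschitz hL hf (hU a) hs
  rw [Metric.mem_ball, Real.dist_eq, lt_div_iff₀ hC] at hb
  have h2 : U a s₀ ≤ U a s := hmin hs
  have h3 := abs_le.1 h1
  linarith

variable {a : ℝ} {u : ℝ → ℝ}

theorem IsRadialIVP.hasDerivAt_radialMean (hu : IsRadialIVP n f a u) (hf : Continuous f) {r : ℝ}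
    (hr : 0 < r) :
    HasDerivAt (radialMean n fun t => f (u t))
      (f (u r) - n / r * radialMean n (fun t => f (u t)) r) r :=
  _root_.hasDerivAt_radialMean n (hf.comp hu.continuous) hr

/-- A solution with a double zero vanishes. -/
theorem IsRadialIVP.eq_zero_of_double_zero (hL : 0 ≤ L) (hf : ∀ x y, |f x - f y| ≤ L * |x - y|)
    (hf0 : f 0 = 0) (hu : IsRadialIVP n f a u) {s : ℝ} (hs : 0 < s) (h0 : u s = 0)
    (h1 : radialMean n (fun t => f (u t)) s = 0) : a = 0 := by
  have hfc := continuous_of_abs_sub_le hL hf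
  have hzero : ∀ ε ∈ Ioo 0 s, u ε = 0 := by
    rintro ε ⟨hε, hεs⟩
    set p := radialMean n fun t => f (u t) with hp
    -- C makes (u² + p²) exp(Ct) nondecreasing on [ε, s]: 1 pays for the cross term 2up, L for 2p
    -- f(u), and 2n/ε for the friction. A zero at s then propagates back to ε.
    set C := 1 + L + 2 * (n / ε) with hC
    have hD : ∀ t, 0 < t → HasDerivAt (fun t => (u t ^ 2 + p t ^ 2) * Real.exp (C * t))
        ((2 * u t * (-p t) + 2 * p t * (f (u t) - n / t * p t)) * Real.exp (C * t) +
          (u t ^ 2 + p t ^ 2) * (Real.exp (C * t) * C)) t := by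
      intro t ht
      have hu' := (hu.hasDerivAt t ht.le).pow 2
      have hp' := (hu.hasDerivAt_radialMean hfc ht).pow 2
      have he : HasDerivAt (fun t => Real.exp (C * t)) (Real.exp (C * t) * C) t := by
        simpa using ((hasDerivAt_id t).const_mul C).exp
      refine ((hu'.add hp').mul he).congr_deriv ?_
      simp [hp]
    have hmono : MonotoneOn (fun t => (u t ^ 2 + p t ^ 2) * Real.exp (C * t)) (Icc ε s) := by
      refine monotoneOn_of_deriv_nonneg (convex_Icc _ _)
        (fun t ht => (hD t (hε.trans_le ht.1)).continuousAt.continuousWithinAt)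
        (fun t ht => ?_) (fun t ht => ?_)
      · rw [interior_Icc] at ht
        exact (hD t (hε.trans ht.1)).differentiableAt.differentiableWithinAt
      · rw [interior_Icc] at ht
        have ht0 := hε.trans ht.1
        rw [(hD t ht0).deriv]
        have hfu : |f (u t)| ≤ L * |u t| := by simpa [hf0] using hf (u t) 0
        have h2 : -(L * (p t ^ 2 + u t ^ 2)) ≤ 2 * p t * f (u t) := by
          have h3 : |p t * f (u t)| ≤ L * (|p t| * |u t|) := by
            rw [abs_mul]
            nlinarith [abs_nonneg (p t)]
          have h4 := (abs_le.1 h3).1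
          nlinarith [mul_nonneg hL (sq_nonneg (|p t| - |u t|)), sq_abs (p t), sq_abs (u t)]
        have h5 : n / t * p t ^ 2 ≤ n / ε * p t ^ 2 := by
          gcongr
          exact ht.1.le
        have h6 : 0 ≤ n / ε * u t ^ 2 := by positivity
        have h7 : 0 ≤ (2 * u t * (-p t) + 2 * p t * (f (u t) - n / t * p t)) +
            (u t ^ 2 + p t ^ 2) * C := by
          rw [hC]
          nlinarith [sq_nonneg (u t - p t)]
        have := mul_nonneg h7 (Real.exp_pos (C * t)).le
        linarith
    have := hmono ⟨le_rfl, hεs.le⟩ ⟨hεs.le, le_rfl⟩ hεs.le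
    simp only [h0, h1, ne_eq, OfNat.ofNat_ne_zero, not_false_eq_true, zero_pow, add_zero,
      zero_mul] at this
    have h2 := nonpos_of_mul_nonpos_left this (Real.exp_pos _)
    nlinarith [sq_nonneg (u ε), sq_nonneg (p ε)]
  have hlim : Filter.Tendsto u (nhdsWithin 0 (Ioi 0)) (nhds (u 0)) :=
    hu.continuous.continuousAt.continuousWithinAt
  have hlim' : Filter.Tendsto u (nhdsWithin 0 (Ioi 0)) (nhds 0) := by
    refine tendsto_const_nhds.congr' ?_
    filter_upwards [Ioo_mem_nhdsGT hs] with t ht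
    exact (hzero t ht).symm
  rw [← hu.init]
  exact tendsto_nhds_unique hlim hlim'

/-- A zero at r > 0 would be a minimum, hence a double zero. -/
theorem IsRadialIVP.pos_of_nonneg (hL : 0 ≤ L) (hf : ∀ x y, |f x - f y| ≤ L * |x - y|)
    (hf0 : f 0 = 0) (hu : IsRadialIVP n f a u) (ha : a ≠ 0) (h : ∀ r, 0 ≤ r → 0 ≤ u r) {r : ℝ}
    (hr : 0 ≤ r) : 0 < u r := by
  refine (h r hr).lt_of_ne fun h0 => ha ?_
  rcases hr.eq_or_lt with rfl | hr
  · rw [← hu.init, ← h0]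
  · refine hu.eq_zero_of_double_zero hL hf hf0 hr h0.symm ?_
    have hmin : IsLocalMin u r := by
      filter_upwards [lt_mem_nhds hr] with t ht
      rw [← h0]
      exact h t ht.le
    have := hmin.hasDerivAt_eq_zero (hu.hasDerivAt r hr.le)
    linarith

end Lipschitz

/-! ### Oscillation of the linear equation and sign change at large height -/

/-- Solutions of the linear equation `u'' + (n / r) u' + c u = 0` oscillate. -/
theorem IsRadialIVP.exists_neg_of_linear {n : ℕ} {c : ℝ} (hc : 0 < c) (hc1 : c ≤ 1) {u : ℝ → ℝ}
    (hu : IsRadialIVP n (fun x => c * x) 1 u) : ∃ r, 0 ≤ r ∧ u r < 0 := by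
  by_contra! hneg
  have hf : ∀ x y : ℝ, |c * x - c * y| ≤ c * |x - y| := fun x y => by
    rw [← mul_sub, abs_mul, abs_of_pos hc]
  have hpos : ∀ r, 0 ≤ r → 0 < u r := fun r hr =>
    hu.pos_of_nonneg hc.le hf (mul_zero c) one_ne_zero hneg hr
  set p := radialMean n fun t => c * u t with hp
  -- Prüfer angle: beyond R, where n/r ≤ c, it grows at rate at least c/2. Over a length 4π/c it
  -- would gain 2π, but arctan has range of length π.
  have hD : ∀ r, 0 < r → HasDerivAt (fun r => Real.arctan (p r / u r))
      (1 / (1 + (p r / u r) ^ 2) *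
        (((c * u r - n / r * p r) * u r - p r * (-p r)) / u r ^ 2)) r := fun r hr =>
    ((hu.hasDerivAt_radialMean (by fun_prop) hr).div (hu.hasDerivAt r hr.le)
      (hpos r hr.le).ne').arctan
  set R : ℝ := (n + 1) / c with hR
  have hR0 : 0 < R := by positivity
  have hge : ∀ r, R < r → c / 2 ≤ deriv (fun r => Real.arctan (p r / u r)) r := by
    intro r hr
    have hr0 := hR0.trans hr
    have hu0 := hpos r hr0.le
    rw [(hD r hr0).deriv]
    have h1 : 1 / (1 + (p r / u r) ^ 2) *
        (((c * u r - n / r * p r) * u r - p r * (-p r)) / u r ^ 2) =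
        (c * u r ^ 2 - n / r * (p r * u r) + p r ^ 2) / (u r ^ 2 + p r ^ 2) := by
      field_simp
      ring
    rw [h1, le_div_iff₀ (by positivity)]
    have h2 : n / r ≤ c := by
      rw [div_le_iff₀ hr0]
      rw [hR, div_lt_iff₀ hc] at hr
      nlinarith
    have h3 : 0 ≤ n / r := by positivity
    have h4 : n / r * (p r * u r) ≤ c * (p r ^ 2 + u r ^ 2) / 2 := by
      nlinarith [mul_nonneg h3 (sq_nonneg (p r - u r)),
        mul_nonneg (sub_nonneg.2 h2) (add_nonneg (sq_nonneg (p r)) (sq_nonneg (u r)))]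
    nlinarith [mul_nonneg (sub_nonneg.2 hc1) (sq_nonneg (p r))]
  have hlt : R < R + 4 * Real.pi / c := by
    have := Real.pi_pos
    have : 0 < 4 * Real.pi / c := by positivity
    linarith
  have := (convex_Icc R (R + 4 * Real.pi / c)).mul_sub_le_image_sub_of_le_deriv
    (fun t ht => (hD t (hR0.trans_le ht.1)).continuousAt.continuousWithinAt)
    (fun t ht => (hD t (hR0.trans (by rw [interior_Icc] at ht; exact
      ht.1))).differentiableAt.differentiableWithinAt)
    (fun t ht => hge t (by rw [interior_Icc] at ht; exact ht.1))
    R ⟨le_rfl, hlt.le⟩ _ ⟨hlt.le, le_rfl⟩ hlt.le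
  have h1 := Real.arctan_lt_pi_div_two (p (R + 4 * Real.pi / c) / u (R + 4 * Real.pi / c))
  have h2 := Real.neg_pi_div_two_lt_arctan (p R / u R)
  have h3 : c / 2 * (R + 4 * Real.pi / c - R) = 2 * Real.pi := by
    field_simp
    ring
  have := Real.pi_pos
  linarith

/-- The saturated nonlinearity `u³ / (1 + u²) - ω u`, written with `c = 1 - ω`. -/
noncomputable def saturated (c x : ℝ) : ℝ := c * x - x / (1 + x ^ 2)

theorem saturated_zero (c : ℝ) : saturated c 0 = 0 := by simp [saturated]

theorem abs_saturated_sub_le {c : ℝ} (hc : 0 < c) (hc1 : c ≤ 1) (x y : ℝ) :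
    |saturated c x - saturated c y| ≤ 2 * |x - y| := by
  have h1 : saturated c x - saturated c y =
      (c - (1 - x * y) / ((1 + x ^ 2) * (1 + y ^ 2))) * (x - y) := by
    unfold saturated
    field_simp
    ring
  rw [h1, abs_mul]
  gcongr
  have h2 : |(1 - x * y) / ((1 + x ^ 2) * (1 + y ^ 2))| ≤ 1 := by
    rw [abs_div, abs_of_pos (a := (1 + x ^ 2) * (1 + y ^ 2)) (by positivity),
      div_le_one (by positivity), abs_le]
    constructor <;> nlinarith [sq_nonneg (x - y), sq_nonneg (x + y), sq_nonneg (x * y)]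
  have h3 := abs_le.1 h2
  rw [abs_le]
  constructor <;> linarith

theorem continuous_saturated (c : ℝ) : Continuous (saturated c) := by
  unfold saturated
  exact (continuous_const.mul continuous_id).sub
    (continuous_id.div (by fun_prop) fun x => by positivity)

theorem abs_saturated_sub_linear_le (c x : ℝ) : |saturated c x - c * x| ≤ 1 / 2 := by
  have : saturated c x - c * x = -(x / (1 + x ^ 2)) := by
    unfold saturated
    ring
  rw [this, abs_neg, abs_div, abs_of_pos (a := 1 + x ^ 2) (by positivity),
    div_le_iff₀ (by positivity)]
  nlinarith [sq_nonneg (|x| - 1), sq_abs x]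

theorem exists_radialIVP_saturated_neg (n : ℕ) {c : ℝ} (hc : 0 < c) (hc1 : c ≤ 1)
    {U : ℝ → ℝ → ℝ} (hU : ∀ a, IsRadialIVP n (saturated c) a (U a)) :
    ∃ a, 0 < a ∧ ∃ r, 0 ≤ r ∧ U a r < 0 := by
  have hf : ∀ x y : ℝ, |c * x - c * y| ≤ c * |x - y| := fun x y => by
    rw [← mul_sub, abs_mul, abs_of_pos hc]
  obtain ⟨J, hJ⟩ := exists_isRadialIVP n hc.le hf (mul_zero c) 1
  obtain ⟨r, hr, hneg⟩ := hJ.exists_neg_of_linear hc hc1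
  set K := 2 * (1 / 2 * r ^ 2) * Real.exp ((c + 1) * r) with hK
  have hK0 : 0 ≤ K := by positivity
  -- K bounds the distance to the linear solution at r independently of the height; this a puts the
  -- linear solution at -(K + 1).
  set a := (K + 1) / (-J r) with ha
  have ha0 : 0 < a := div_pos (by linarith) (by linarith)
  have haJ : IsRadialIVP n (fun x => c * x) a fun t => a * J t := by
    refine ⟨continuous_const.mul hJ.continuous, by simp [hJ.init], fun t ht => ?_⟩
    have h1 : ∀ s, c * (a * J s) = a * (c * J s) := fun s => by ring
    simp only [h1, radialMean_const_mul]
    rw [← mul_neg]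
    have := (hJ.hasDerivAt t ht).const_mul a
    simpa only [radialMean_const_mul] using this
  refine ⟨a, ha0, r, hr, ?_⟩
  have := (hU a).abs_sub_le haJ (continuous_saturated c) (by fun_prop) (η := 1 / 2) hc.le
    (by norm_num) hr (fun t => ?_) ⟨hr, le_rfl⟩
  · rw [sub_self, abs_zero, zero_add, ← hK] at this
    have h1 := (abs_le.1 this).2
    have h2 : a * J r = -(K + 1) := by
      rw [ha]
      field_simp [hneg.ne]
    linarith
  · have h1 := abs_saturated_sub_linear_le c (U a t)
    have h2 := hf (U a t) (a * J t)
    have h3 := abs_add_le (saturated c (U a t) - c * U a t) (c * U a t - c * (a * J t))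
    rw [sub_add_sub_cancel] at h3
    linarith

/-! ### Potential, energy and shooting -/

/-- The primitive of `saturated c` vanishing at `0`. -/
noncomputable def saturatedPotential (c x : ℝ) : ℝ := c * x ^ 2 / 2 - Real.log (1 + x ^ 2) / 2

theorem saturatedPotential_zero (c : ℝ) : saturatedPotential c 0 = 0 := by
  simp [saturatedPotential]

theorem hasDerivAt_saturatedPotential (c x : ℝ) :
    HasDerivAt (saturatedPotential c) (saturated c x) x := by
  have h1 : HasDerivAt (fun x : ℝ => x ^ 2) (2 * x) x := by simpa using hasDerivAt_pow 2 x
  have h2 := ((h1.const_mul c).div_const 2).sub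
    (((h1.const_add 1).log (by positivity)).div_const 2)
  refine h2.congr_deriv ?_
  unfold saturated
  field_simp

theorem continuous_saturatedPotential (c : ℝ) : Continuous (saturatedPotential c) :=
  continuous_iff_continuousAt.2 fun x => (hasDerivAt_saturatedPotential c x).continuousAt

theorem saturatedPotential_neg {c x : ℝ} (hx : x ≠ 0) (h : c * (2 + x ^ 2) < 2) :
    saturatedPotential c x < 0 := by
  have h1 := Real.le_log_one_add_of_nonneg (sq_nonneg x)
  have h2 : c * x ^ 2 < 2 * x ^ 2 / (x ^ 2 + 2) := by
    rw [lt_div_iff₀ (by positivity)]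
    have : 0 < x ^ 2 := by positivity
    nlinarith
  unfold saturatedPotential
  linarith

/-- F(x) ≥ 0 forces x² ≥ 2(1 - c)/c, hence 1/(1 + x²) ≤ c/(2 - c); κ is the product of the resulting
lower bounds for the factors of f(x) = x (c - 1/(1 + x²)). -/
theorem exists_pos_le_saturated {c : ℝ} (hc : 0 < c) (hc1 : c < 1) :
    ∃ κ, 0 < κ ∧ ∀ x, 0 < x → 0 ≤ saturatedPotential c x → κ ≤ saturated c x := by
  have hm : 0 < 2 * (1 - c) / c := div_pos (by linarith) hc
  have h2c : 0 < 2 - c := by linarith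
  have hq : 0 < c * (1 - c) / (2 - c) := div_pos (mul_pos hc (by linarith)) h2c
  refine ⟨√(2 * (1 - c) / c) * (c * (1 - c) / (2 - c)), by positivity, fun x hx hF => ?_⟩
  have h1 : 2 ≤ c * (2 + x ^ 2) := by
    by_contra! h
    exact (saturatedPotential_neg hx.ne' h).not_ge hF
  have h2 : √(2 * (1 - c) / c) ≤ x := by
    rw [Real.sqrt_le_left hx.le, div_le_iff₀ hc]
    linarith
  have h3 : c * (1 - c) / (2 - c) ≤ c - 1 / (1 + x ^ 2) := by
    have h4 : 1 / (1 + x ^ 2) ≤ c / (2 - c) := by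
      rw [div_le_div_iff₀ (by positivity) h2c]
      linarith
    have h5 : c * (1 - c) / (2 - c) = c - c / (2 - c) := by
      field_simp
      ring
    linarith
  calc _ ≤ x * (c - 1 / (1 + x ^ 2)) := by gcongr
    _ = _ := by
      unfold saturated
      ring

theorem neg_sq_div_two_le_saturatedPotential {c : ℝ} (hc : 0 ≤ c) (x : ℝ) :
    -(x ^ 2 / 2) ≤ saturatedPotential c x := by
  have h1 := Real.log_le_sub_one_of_pos (show 0 < 1 + x ^ 2 by positivity)
  have h2 : 0 ≤ c * x ^ 2 := by positivity
  unfold saturatedPotential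
  linarith

/-- F(x)/x² is nondecreasing for x > 0: 1 + x² is a convex combination of 1 + y² and 1, and log is
concave. -/
theorem saturatedPotential_le_of_le (c : ℝ) {x y : ℝ} (hx : 0 < x) (hxy : x ≤ y) :
    saturatedPotential c x ≤ x ^ 2 / y ^ 2 * saturatedPotential c y := by
  have hy : 0 < y := hx.trans_le hxy
  have hθ : x ^ 2 / y ^ 2 ≤ 1 := by
    rw [div_le_one (by positivity)]
    gcongr
  have h1 := strictConcaveOn_log_Ioi.concaveOn.2
    (mem_Ioi.2 (by positivity : 0 < 1 + y ^ 2)) (mem_Ioi.2 one_pos)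
    (by positivity : 0 ≤ x ^ 2 / y ^ 2) (sub_nonneg.2 hθ) (by ring)
  have h2 : x ^ 2 / y ^ 2 * (1 + y ^ 2) + (1 - x ^ 2 / y ^ 2) * 1 = 1 + x ^ 2 := by
    field_simp
    ring
  simp only [smul_eq_mul] at h1
  rw [h2, Real.log_one, mul_zero, add_zero] at h1
  unfold saturatedPotential
  have h3 : x ^ 2 / y ^ 2 * (c * y ^ 2 / 2 - Real.log (1 + y ^ 2) / 2) =
      c * x ^ 2 / 2 - x ^ 2 / y ^ 2 * Real.log (1 + y ^ 2) / 2 := by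
    field_simp
  rw [h3]
  linarith

/-- The energy `u'² / 2 + F(u)` of a solution of the radial equation. -/
noncomputable def radialEnergy (n : ℕ) (c : ℝ) (u : ℝ → ℝ) (r : ℝ) : ℝ :=
  radialMean n (fun t => saturated c (u t)) r ^ 2 / 2 + saturatedPotential c (u r)

theorem IsRadialIVP.antitoneOn_radialEnergy {n : ℕ} {c a : ℝ} {u : ℝ → ℝ}
    (hu : IsRadialIVP n (saturated c) a u) : AntitoneOn (radialEnergy n c u) (Ici 0) := by
  have hfc := continuous_saturated c
  have hD : ∀ r, 0 < r → HasDerivAt (radialEnergy n c u)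
      (-(n / r * radialMean n (fun t => saturated c (u t)) r ^ 2)) r := by
    intro r hr
    have h1 := ((hu.hasDerivAt_radialMean hfc hr).pow 2).div_const 2
    have h2 := (hasDerivAt_saturatedPotential c (u r)).comp r (hu.hasDerivAt r hr.le)
    refine (h1.add h2).congr_deriv ?_
    simp
    ring
  have hc : Continuous (radialEnergy n c u) := by
    have h1 := continuous_radialMean n (hfc.comp hu.continuous)
    have h2 := (continuous_saturatedPotential c).comp hu.continuous
    exact ((h1.pow 2).div_const 2).add h2
  refine antitoneOn_of_deriv_nonpos (convex_Ici 0) hc.continuousOn (fun r hr => ?_) fun r hr => ?_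
  · rw [interior_Ici] at hr
    exact (hD r hr).differentiableAt.differentiableWithinAt
  · rw [interior_Ici] at hr
    rw [(hD r hr).deriv]
    have : 0 < r := hr
    rw [neg_nonpos]
    positivity

theorem exists_radialIVP_saturated_pos (n : ℕ) {c : ℝ} (hc : 0 < c) (hc1 : c < 1) :
    ∃ a u, 0 < a ∧ IsRadialIVP n (saturated c) a u ∧
      (∀ r, 0 ≤ r → 0 < u r) ∧ ∀ r, 0 ≤ r → 0 ≤ radialEnergy n c u r := by
  have hf := abs_saturated_sub_le hc hc1.le
  have hf0 := saturated_zero c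
  choose U hU using exists_isRadialIVP n zero_le_two hf hf0
  by_contra! hcon
  set N := {a | ∃ r, 0 ≤ r ∧ U a r < 0} with hN
  -- Positivity up to r is needed for disjointness from N: F is even, so a solution may also reach
  -- negative energy after crossing zero.
  set P := {a | ∃ r, 0 ≤ r ∧ radialEnergy n c (U a) r < 0 ∧ ∀ s ∈ Icc 0 r, 0 < U a s} with hP
  have hNo : IsOpen N := isOpen_exists_neg zero_le_two hf hU
  have hPo : IsOpen P := by
    have : P = ⋃ r : {r : ℝ // 0 ≤ r},
        {a | radialEnergy n c (U a) r < 0} ∩ {a | ∀ s ∈ Icc 0 (r : ℝ), 0 < U a s} := by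
      ext a
      simp only [hP, mem_iUnion, mem_inter_iff, mem_ofPred_eq, Subtype.exists, exists_prop]
    rw [this]
    refine isOpen_iUnion fun r => IsOpen.inter (isOpen_lt ?_ continuous_const)
      (isOpen_forall_pos zero_le_two hf hU r.2)
    have h1 := continuous_radialMean_radialIVP zero_le_two hf hU r.2
    have h2 := (continuous_saturatedPotential c).comp (continuous_radialIVP zero_le_two hf hU r.2)
    exact ((h1.pow 2).div_const 2).add h2
  have hcover : Ioi 0 ⊆ N ∪ P := by
    intro a ha
    by_contra hmem
    simp only [mem_union, not_or] at hmem
    obtain ⟨h1, h2⟩ := hmem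
    have hnn : ∀ r, 0 ≤ r → 0 ≤ U a r := fun r hr => by
      by_contra! h
      exact h1 ⟨r, hr, h⟩
    have hpos : ∀ r, 0 ≤ r → 0 < U a r := fun r hr =>
      (hU a).pos_of_nonneg zero_le_two hf hf0 (ne_of_gt ha) hnn hr
    obtain ⟨r, hr, hE⟩ := hcon a (U a) ha (hU a) hpos
    exact h2 ⟨r, hr, hE, fun s hs => hpos s hs.1⟩
  have hNn : (Ioi 0 ∩ N).Nonempty := by
    obtain ⟨a, ha, h⟩ := exists_radialIVP_saturated_neg n hc hc1.le hU
    exact ⟨a, ha, h⟩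
  have hPn : (Ioi 0 ∩ P).Nonempty := by
    have hq : 0 < (1 - c) / c := div_pos (by linarith) hc
    have ha : 0 < √((1 - c) / c) := Real.sqrt_pos.2 hq
    -- At this height c (2 + a²) = 1 + c < 2, so F(a) < 0; at r = 0 the energy is F(a).
    refine ⟨√((1 - c) / c), ha, 0, le_rfl, ?_, fun s hs => ?_⟩
    · unfold radialEnergy
      rw [radialMean_zero, (hU _).init]
      have := saturatedPotential_neg (c := c) ha.ne' (by
        rw [Real.sq_sqrt hq.le, mul_add, mul_div_cancel₀ _ hc.ne']
        linarith)
      simpa using this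
    · have : s = 0 := le_antisymm hs.2 hs.1
      rw [this, (hU _).init]
      exact ha
  obtain ⟨a, -, ⟨s, hs, hneg⟩, r, hr, hE, hpos⟩ :=
    isPreconnected_Ioi N P hNo hPo hcover hNn hPn
  have hrs : r < s := by
    by_contra! h
    exact (hpos s ⟨hs, h⟩).not_gt hneg
  obtain ⟨t, ht, h0⟩ := intermediate_value_Icc' hrs.le (hU a).continuous.continuousOn
    (show (0 : ℝ) ∈ Icc (U a s) (U a r) from ⟨hneg.le, (hpos r ⟨hr, le_rfl⟩).le⟩)
  have h1 := (hU a).antitoneOn_radialEnergy (mem_Ici.2 hr) (mem_Ici.2 (hr.trans ht.1)) ht.1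
  have h2 : 0 ≤ radialEnergy n c (U a) t := by
    unfold radialEnergy
    rw [h0, saturatedPotential_zero]
    positivity
  linarith

/-! ### Monotonicity and decay of the profile -/

section Profile

variable {n : ℕ} {c a : ℝ} {u : ℝ → ℝ}

/-- At a zero of p, E ≥ 0 gives F(u) ≥ 0, so f(u) ≥ κ. Thus p becomes positive just after 0 and has
positive derivative at any later zero, so it cannot return to zero. -/
theorem IsRadialIVP.radialMean_pos (hc : 0 < c) (hc1 : c < 1)
    (hu : IsRadialIVP n (saturated c) a u) (hpos : ∀ r, 0 ≤ r → 0 < u r)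
    (hE : ∀ r, 0 ≤ r → 0 ≤ radialEnergy n c u r) {r : ℝ} (hr : 0 < r) :
    0 < radialMean n (fun t => saturated c (u t)) r := by
  obtain ⟨κ, hκ, hκf⟩ := exists_pos_le_saturated hc hc1
  have hfc := continuous_saturated c
  have hfu : Continuous fun t => saturated c (u t) := hfc.comp hu.continuous
  set p := radialMean n fun t => saturated c (u t) with hp
  have hcrit : ∀ t, 0 ≤ t → p t = 0 → κ ≤ saturated c (u t) := by
    intro t ht h0
    refine hκf _ (hpos t ht) ?_
    have := hE t ht
    unfold radialEnergy at this
    rw [← hp, h0] at this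
    simpa using this
  obtain ⟨δ, hδ, hpδ⟩ : ∃ δ ∈ Ioo 0 r, 0 < p δ := by
    have h0 := hcrit 0 le_rfl (radialMean_zero n _)
    have hev : ∀ᶠ t in nhds 0, κ / 2 < saturated c (u t) :=
      hfu.continuousAt.eventually_const_lt (by linarith)
    obtain ⟨ε, hε, hball⟩ := Metric.eventually_nhds_iff.1 hev
    refine ⟨min ε r / 2, ⟨by positivity, ?_⟩, ?_⟩
    · have := min_le_right ε r
      linarith
    · have hm : 0 < min ε r / 2 := by positivity
      refine lt_of_lt_of_le ?_ (le_radialMean n hfu (c := κ / 2) hm.le fun t ht => ?_)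
      · positivity
      · refine (hball ?_).le
        rw [Real.dist_eq, sub_zero, abs_of_nonneg ht.1]
        have := min_le_left ε r
        linarith [ht.2]
  have hD : ∀ t, 0 < t → HasDerivAt p (saturated c (u t) - n / t * p t) t :=
    fun t ht => hu.hasDerivAt_radialMean hfc ht
  -- Going past r makes r an interior point, so a zero there would be a local minimum of p.
  have hnonneg : ∀ t ∈ Icc δ (r + 1), 0 ≤ p t := by
    intro t ht
    have := image_le_of_deriv_right_lt_deriv_boundary (f := fun t => -p t) (B := fun _ => 0)
      (B' := fun _ => 0) (a := δ) (b := r + 1)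
      (fun t ht => (hD t (hδ.1.trans_le ht.1)).neg.continuousAt.continuousWithinAt)
      (fun t ht => (hD t (hδ.1.trans_le ht.1)).neg.hasDerivWithinAt)
      (by simpa using hpδ.le) (fun t => hasDerivAt_const t 0) (fun t ht h0 => ?_) ht
    · simpa using this
    · have h1 : p t = 0 := by simpa using h0
      have h2 := hcrit t (hδ.1.le.trans ht.1) h1
      rw [h1]
      linarith
  refine (hnonneg r ⟨hδ.2.le, by linarith⟩).lt_of_ne fun h0 => ?_
  have hmin : IsLocalMin p r := by
    filter_upwards [Icc_mem_nhds hδ.2 (lt_add_one r)] with t ht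
    rw [← h0]
    exact hnonneg t ht
  have h1 := hmin.hasDerivAt_eq_zero (hD r hr)
  have h2 := hcrit r hr.le h0.symm
  rw [← h0] at h1
  linarith

theorem IsRadialIVP.antitoneOn_profile (hc : 0 < c) (hc1 : c < 1)
    (hu : IsRadialIVP n (saturated c) a u) (hpos : ∀ r, 0 ≤ r → 0 < u r)
    (hE : ∀ r, 0 ≤ r → 0 ≤ radialEnergy n c u r) : AntitoneOn u (Ici 0) := by
  refine antitoneOn_of_deriv_nonpos (convex_Ici 0) hu.continuous.continuousOn
    (fun r hr => ?_) fun r hr => ?_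
  · rw [interior_Ici] at hr
    exact (hu.hasDerivAt r (le_of_lt hr)).differentiableAt.differentiableWithinAt
  · rw [interior_Ici] at hr
    rw [(hu.hasDerivAt r (le_of_lt hr)).deriv]
    exact neg_nonpos.2 (hu.radialMean_pos hc hc1 hpos hE hr).le

/-- Otherwise f(u) ≥ κ throughout and p ≥ κ r/(n + 1) eventually violates p²/2 ≤ E(0). -/
theorem IsRadialIVP.exists_saturatedPotential_neg (hc : 0 < c) (hc1 : c < 1)
    (hu : IsRadialIVP n (saturated c) a u) (hpos : ∀ r, 0 ≤ r → 0 < u r) :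
    ∃ r, 0 ≤ r ∧ saturatedPotential c (u r) < 0 := by
  by_contra! hF
  obtain ⟨κ, hκ, hκf⟩ := exists_pos_le_saturated hc hc1
  set E := radialEnergy n c u 0 with hEdef
  have hE0 : 0 ≤ E := by
    rw [hEdef]
    unfold radialEnergy
    have := hF 0 le_rfl
    positivity
  set r := (n + 1) / κ * (E + 1) with hr
  have hr0 : 0 ≤ r := by positivity
  have h1 := le_radialMean n ((continuous_saturated c).comp hu.continuous) (c := κ) hr0
    fun t ht => hκf _ (hpos t ht.1) (hF t ht.1)
  have h2 : r * (κ / (n + 1)) = E + 1 := by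
    rw [hr]
    field_simp
  rw [h2] at h1
  have h3 := hu.antitoneOn_radialEnergy (mem_Ici.2 le_rfl) (mem_Ici.2 hr0) hr0
  rw [← hEdef] at h3
  have h4 := hF r hr0
  unfold radialEnergy at h3
  simp only [Function.comp_def] at h1
  nlinarith

/-- E ≥ 0 gives p² ≥ -2F(u), and past a point with F < 0 the monotonicity of F(x)/x² bounds -F(u)
below by a multiple of u². -/
theorem IsRadialIVP.exists_sq_le (hc : 0 < c) (hc1 : c < 1)
    (hu : IsRadialIVP n (saturated c) a u) (hpos : ∀ r, 0 ≤ r → 0 < u r)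
    (hE : ∀ r, 0 ≤ r → 0 ≤ radialEnergy n c u r) :
    ∃ r₀ K, 0 ≤ r₀ ∧ ∀ r, r₀ ≤ r →
      u r ^ 2 ≤ K * radialMean n (fun t => saturated c (u t)) r ^ 2 := by
  obtain ⟨r₀, hr₀, hF⟩ := hu.exists_saturatedPotential_neg hc hc1 hpos
  set k := -2 * saturatedPotential c (u r₀) with hk
  have hk0 : 0 < k := by linarith
  refine ⟨r₀, u r₀ ^ 2 / k, hr₀, fun r hr => ?_⟩
  have hr0 := hr₀.trans hr
  have h1 := saturatedPotential_le_of_le c (hpos r hr0)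
    (hu.antitoneOn_profile hc hc1 hpos hE (mem_Ici.2 hr₀) (mem_Ici.2 hr0) hr)
  have h2 := hE r hr0
  unfold radialEnergy at h2
  have hu0 := hpos r₀ hr₀
  have h3 : u r ^ 2 / u r₀ ^ 2 * k ≤ radialMean n (fun t => saturated c (u t)) r ^ 2 := by
    rw [hk]
    linarith
  calc u r ^ 2 = u r₀ ^ 2 / k * (u r ^ 2 / u r₀ ^ 2 * k) := by field_simp
    _ ≤ _ := by gcongr

end Profile

/-! ### Weak derivatives and square integrability -/

theorem hasWeakDerivOn_Ioi {f g : ℝ → ℝ} (hf : ∀ x, 0 < x → HasDerivAt f (g x) x)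
    (hg : ContinuousOn g (Ioi 0)) : HasWeakDerivOn f g (Ioi 0) := by
  have hfc : ContinuousOn f (Ioi 0) := fun x hx => (hf x hx).continuousAt.continuousWithinAt
  refine ⟨hfc.locallyIntegrableOn measurableSet_Ioi, hg.locallyIntegrableOn measurableSet_Ioi,
    fun φ hφ hsupp hsub => ?_⟩
  have hφd : Continuous (deriv φ) := hφ.continuous_deriv (by simp)
  have hint : ∀ v w : ℝ → ℝ, ContinuousOn v (Ioi 0) → Continuous w →
      (∀ x, x ∉ tsupport φ → w x = 0) → IntegrableOn (v * w) (Ioi 0) := by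
    intro v w hv hw h0
    have h1 : IntegrableOn (v * w) (tsupport φ) :=
      ((hv.mono hsub).mul hw.continuousOn).integrableOn_compact hsupp
    refine h1.of_forall_sdiff_eq_zero measurableSet_Ioi fun x hx => ?_
    simp [h0 x hx.2]
  have hev0 : ∀ᶠ x in nhds 0, φ x = 0 := by
    have : (tsupport φ)ᶜ ∈ nhds (0 : ℝ) :=
      (isClosed_tsupport φ).isOpen_compl.mem_nhds fun h => lt_irrefl (0 : ℝ) (hsub h)
    filter_upwards [this] with x hx
    exact image_eq_zero_of_notMem_tsupport hx
  have hevtop : ∀ᶠ x in Filter.atTop, φ x = 0 := by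
    obtain ⟨R, hR⟩ := hsupp.isCompact.bddAbove
    filter_upwards [Filter.eventually_gt_atTop R] with x hx
    exact image_eq_zero_of_notMem_tsupport fun h => (hR h).not_gt hx
  have := integral_Ioi_mul_deriv_eq_deriv_mul (a := 0) (a' := 0) (b' := 0) (u := f) (v := φ)
    (u' := g) (v' := deriv φ) (fun x hx => hf x hx)
    (fun x _ => (hφ.differentiable (by simp) x).hasDerivAt)
    (hint f _ hfc hφd fun x hx => by
      by_contra h
      exact hx (support_deriv_subset h))
    (hint g _ hg hφ.continuous fun x hx => image_eq_zero_of_notMem_tsupport hx)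
    (by
      refine tendsto_const_nhds.congr' ?_
      filter_upwards [nhdsWithin_le_nhds hev0] with x hx
      simp [hx])
    (by
      refine tendsto_const_nhds.congr' ?_
      filter_upwards [hevtop] with x hx
      simp [hx])
  rw [this]
  simp

section Profile

variable {n : ℕ} {c a : ℝ} {u : ℝ → ℝ}

/-- p = -u' is positive with integral a - u(R) ≤ a over [0, R], and the energy bounds it, so p² ≤ Mp
is integrable. -/
theorem IsRadialIVP.memLp_radialMean (hc : 0 < c) (hc1 : c < 1)
    (hu : IsRadialIVP n (saturated c) a u) (hpos : ∀ r, 0 ≤ r → 0 < u r)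
    (hE : ∀ r, 0 ≤ r → 0 ≤ radialEnergy n c u r) :
    MemLp (radialMean n fun t => saturated c (u t)) 2 (volume.restrict (Ioi 0)) := by
  have hfu : Continuous fun t => saturated c (u t) := (continuous_saturated c).comp hu.continuous
  have hpc := continuous_radialMean n hfu
  have hppos : ∀ r, 0 < r → 0 < radialMean n (fun t => saturated c (u t)) r :=
    fun r hr => hu.radialMean_pos hc hc1 hpos hE hr
  set p := radialMean n fun t => saturated c (u t) with hp
  have hint : IntegrableOn p (Ioi 0) := by
    refine integrableOn_Ioi_of_intervalIntegral_norm_bounded (l := Filter.atTop) (b := id) a 0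
      (fun i => (hpc.integrableOn_Icc (a := 0) (b := i)).mono_set Ioc_subset_Icc_self)
      Filter.tendsto_id ?_
    filter_upwards [Filter.eventually_ge_atTop 0] with R hR
    have h1 : ∫ x in (0 : ℝ)..R, ‖p x‖ = ∫ x in (0 : ℝ)..R, p x := by
      refine intervalIntegral.integral_congr fun x hx => ?_
      rw [uIcc_of_le hR] at hx
      rcases hx.1.eq_or_lt with rfl | h
      · simp [hp, radialMean_zero]
      · exact Real.norm_of_nonneg (hppos x h).le
    have h2 := hu.eq_sub_integral (continuous_saturated c) hR
    have h3 := hpos R hR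
    simp only [id]
    rw [h1]
    linarith
  rw [memLp_two_iff_integrable_sq hpc.aestronglyMeasurable]
  have hanti := hu.antitoneOn_profile hc hc1 hpos hE
  set M := √(2 * radialEnergy n c u 0 + a ^ 2) with hM
  have hpM : ∀ r, 0 ≤ r → p r ≤ M := by
    intro r hr
    apply Real.le_sqrt_of_sq_le
    have h1 := hu.antitoneOn_radialEnergy (mem_Ici.2 le_rfl) (mem_Ici.2 hr) hr
    have h2 := neg_sq_div_two_le_saturatedPotential hc.le (u r)
    have h3 : u r ≤ a := by
      rw [← hu.init]
      exact hanti (mem_Ici.2 le_rfl) (mem_Ici.2 hr) hr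
    have h4 := hpos r hr
    have h5 : radialEnergy n c u r = p r ^ 2 / 2 + saturatedPotential c (u r) := rfl
    nlinarith
  refine Integrable.mono' (hint.const_mul M) (hpc.pow 2).aestronglyMeasurable ?_
  filter_upwards [ae_restrict_mem measurableSet_Ioi] with r hr
  have h1 := hppos r hr
  have h2 := hpM r (le_of_lt hr)
  rw [Real.norm_of_nonneg (by positivity), sq]
  gcongr

theorem IsRadialIVP.memLp_profile (hc : 0 < c) (hc1 : c < 1)
    (hu : IsRadialIVP n (saturated c) a u) (hpos : ∀ r, 0 ≤ r → 0 < u r)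
    (hE : ∀ r, 0 ≤ r → 0 ≤ radialEnergy n c u r) :
    MemLp u 2 (volume.restrict (Ioi 0)) := by
  have hfu : Continuous fun t => saturated c (u t) := (continuous_saturated c).comp hu.continuous
  have hp := hu.memLp_radialMean hc hc1 hpos hE
  rw [memLp_two_iff_integrable_sq (continuous_radialMean n hfu).aestronglyMeasurable] at hp
  rw [memLp_two_iff_integrable_sq hu.continuous.aestronglyMeasurable]
  obtain ⟨r₀, K, hr₀, hK⟩ := hu.exists_sq_le hc hc1 hpos hE
  change IntegrableOn (fun x => u x ^ 2) (Ioi 0)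
  rw [← Ioc_union_Ioi_eq_Ioi hr₀]
  refine IntegrableOn.union ?_ ?_
  · exact ((hu.continuous.pow 2).integrableOn_Icc).mono_set Ioc_subset_Icc_self
  · have hp' : IntegrableOn (fun x => radialMean n (fun t => saturated c (u t)) x ^ 2)
        (Ioi r₀) := IntegrableOn.mono_set hp (Ioi_subset_Ioi hr₀)
    refine Integrable.mono' (hp'.const_mul K) (hu.continuous.pow 2).aestronglyMeasurable ?_
    filter_upwards [ae_restrict_mem measurableSet_Ioi] with r hr
    rw [Real.norm_of_nonneg (by positivity)]
    exact hK r (le_of_lt hr)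

/-- This is the friction term of u''. Near 0 the bound p ≤ 2ar cancels 1/r; beyond 1 the term is at
most np. -/
theorem IsRadialIVP.memLp_div_mul_radialMean (hc : 0 < c) (hc1 : c < 1)
    (hu : IsRadialIVP n (saturated c) a u) (hpos : ∀ r, 0 ≤ r → 0 < u r)
    (hE : ∀ r, 0 ≤ r → 0 ≤ radialEnergy n c u r) :
    MemLp (fun r => n / r * radialMean n (fun t => saturated c (u t)) r) 2
      (volume.restrict (Ioi 0)) := by
  have hfu : Continuous fun t => saturated c (u t) := (continuous_saturated c).comp hu.continuous
  have hpc := continuous_radialMean n hfu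
  have hppos : ∀ r, 0 < r → 0 < radialMean n (fun t => saturated c (u t)) r :=
    fun r hr => hu.radialMean_pos hc hc1 hpos hE hr
  have hanti := hu.antitoneOn_profile hc hc1 hpos hE
  have hple : ∀ r, 0 ≤ r → radialMean n (fun t => saturated c (u t)) r ≤ r * (2 * a) := by
    intro r hr
    refine (le_abs_self _).trans ((abs_radialMean_le n (φ := fun _ => 2 * a) continuous_const hr
      fun t ht => ?_).trans ?_)
    · have h1 := abs_saturated_sub_le hc hc1.le (u t) 0
      rw [saturated_zero, sub_zero, sub_zero, abs_of_pos (hpos t ht.1)] at h1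
      have h2 : u t ≤ a := by
        rw [← hu.init]
        exact hanti (mem_Ici.2 le_rfl) (mem_Ici.2 ht.1) ht.1
      linarith
    · rw [intervalIntegral.integral_const, smul_eq_mul, sub_zero]
  have hp := hu.memLp_radialMean hc hc1 hpos hE
  rw [memLp_two_iff_integrable_sq hpc.aestronglyMeasurable] at hp
  set p := radialMean n fun t => saturated c (u t) with hpdef
  have hpm : Measurable p := hpc.measurable
  have hqm : Measurable fun r : ℝ => (n / r * p r) := (measurable_const.div measurable_id).mul hpm
  rw [memLp_two_iff_integrable_sq hqm.aestronglyMeasurable]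
  change IntegrableOn (fun x => (n / x * p x) ^ 2) (Ioi 0)
  rw [← Ioc_union_Ioi_eq_Ioi zero_le_one]
  refine IntegrableOn.union ?_ ?_
  · refine Measure.integrableOn_of_bounded (M := (n * (2 * a)) ^ 2) (by simp)
      (hqm.pow_const 2).aestronglyMeasurable ?_
    filter_upwards [ae_restrict_mem measurableSet_Ioc] with r hr
    have h0 := hr.1
    have h1 := hppos r h0
    rw [Real.norm_of_nonneg (by positivity)]
    refine pow_le_pow_left₀ (by positivity) ?_ 2
    calc n / r * p r ≤ n / r * (r * (2 * a)) := by
          gcongr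
          exact hple r h0.le
      _ = _ := by field_simp
  · have hp' : IntegrableOn (fun x => p x ^ 2) (Ioi 1) :=
      IntegrableOn.mono_set hp (Ioi_subset_Ioi zero_le_one)
    refine Integrable.mono' (hp'.const_mul ((n : ℝ) ^ 2))
      (hqm.pow_const 2).aestronglyMeasurable ?_
    filter_upwards [ae_restrict_mem measurableSet_Ioi] with r hr
    have hr1 : 1 < r := hr
    have h1 := hppos r (zero_lt_one.trans hr1)
    rw [Real.norm_of_nonneg (by positivity), ← mul_pow]
    gcongr
    exact div_le_self (by positivity) hr1.le

theorem IsRadialIVP.isRadialSolitaryWave {ω : ℝ} (hω₀ : 0 < ω) (hω₁ : ω < 1)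
    (hu : IsRadialIVP n (saturated (1 - ω)) a u) (hpos : ∀ r, 0 ≤ r → 0 < u r)
    (hE : ∀ r, 0 ≤ r → 0 ≤ radialEnergy n (1 - ω) u r) : IsRadialSolitaryWave (n + 1) ω u := by
  have hc : 0 < 1 - ω := by linarith
  have hc1 : 1 - ω < 1 := by linarith
  have hfc := continuous_saturated (1 - ω)
  have hfu : Continuous fun t => saturated (1 - ω) (u t) := hfc.comp hu.continuous
  have hpc := continuous_radialMean n hfu
  have hpL := hu.memLp_radialMean hc hc1 hpos hE
  have huL := hu.memLp_profile hc hc1 hpos hE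
  have hqL := hu.memLp_div_mul_radialMean hc hc1 hpos hE
  have hu' : ∀ r, 0 < r → HasDerivAt u (-radialMean n (fun t => saturated (1 - ω) (u t)) r) r :=
    fun r hr => hu.hasDerivAt r hr.le
  have hp' := fun r hr => hu.hasDerivAt_radialMean hfc (r := r) hr
  set p := radialMean n fun t => saturated (1 - ω) (u t) with hp
  have hderiv : ∀ r, 0 < r → deriv u r = -p r := fun r hr => (hu' r hr).deriv
  have hu'' : ∀ r, 0 < r → HasDerivAt (deriv u) (-(saturated (1 - ω) (u r) - n / r * p r)) r := by
    intro r hr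
    refine (hp' r hr).neg.congr_of_eventuallyEq ?_
    filter_upwards [lt_mem_nhds hr] with x hx
    exact hderiv x hx
  have hwc : ContinuousOn (fun r => -(saturated (1 - ω) (u r) - n / r * p r)) (Ioi 0) := by
    refine (hfu.continuousOn.sub ((ContinuousOn.div continuousOn_const continuousOn_id ?_).mul
      hpc.continuousOn)).neg
    exact fun x hx => ne_of_gt hx
  have hdd : ∀ r, 0 < r → deriv (deriv u) r = -(saturated (1 - ω) (u r) - n / r * p r) :=
    fun r hr => (hu'' r hr).deriv
  refine ⟨?_, fun r hr => ?_, ⟨huL, fun r => -p r, _,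
    hasWeakDerivOn_Ioi hu' hpc.neg.continuousOn,
    hasWeakDerivOn_Ioi (fun r hr => (hp' r hr).neg) hwc, hpL.neg, (MemLp.sub ?_ hqL).neg⟩, ?_⟩
  · rw [show (2 : WithTop ℕ∞) = 1 + 1 by norm_num, contDiffOn_succ_iff_deriv_of_isOpen isOpen_Ioi]
    refine ⟨fun r hr => (hu' r hr).differentiableAt.differentiableWithinAt, by simp, ?_⟩
    rw [show (1 : WithTop ℕ∞) = 0 + 1 by norm_num, contDiffOn_succ_iff_deriv_of_isOpen isOpen_Ioi]
    refine ⟨fun r hr => (hu'' r hr).differentiableAt.differentiableWithinAt, by simp, ?_⟩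
    rw [contDiffOn_zero]
    exact hwc.congr fun r hr => hdd r hr
  · rw [hdd r hr, hderiv r hr]
    unfold saturated
    push_cast
    field_simp
    ring
  · refine (huL.const_mul 2).mono hfu.aestronglyMeasurable (Filter.Eventually.of_forall fun r => ?_)
    have h1 := abs_saturated_sub_le hc hc1.le (u r) 0
    rw [saturated_zero, sub_zero, sub_zero] at h1
    rw [norm_mul]
    simpa using h1
  · have := hu.hasDerivAt 0 le_rfl
    rw [radialMean_zero, neg_zero] at this
    exact this.hasDerivWithinAt

end Profile

theorem theorem7 (d : ℕ) (hd : 1 ≤ d) (ω : ℝ) (hω₀ : 0 < ω) (hω₁ : ω < 1) :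
    ∃ u : ℝ → ℝ, IsRadialSolitaryWave d ω u ∧ ∀ r : ℝ, 0 ≤ r → 0 < u r := by
  obtain ⟨n, rfl⟩ := Nat.exists_eq_add_of_le' hd
  obtain ⟨a, u, -, hu, hpos, hE⟩ :=
    exists_radialIVP_saturated_pos n (c := 1 - ω) (by linarith) (by linarith)
  exact ⟨u, hu.isRadialSolitaryWave hω₀ hω₁ hpos hE, hpos⟩
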